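/- All random variables have finite ranges. For a tuple $X_1,\dots,X_n$ of jointly distributed random variables, its entropy profile is the vector in $\mathbb{R}^{2^n-1}$ of the Shannon entropies $H(X_S)$ of all sub-tuples $X_S=(X_i)_{i\in S}$, $\emptyset\ne S\subseteq\{1,\dots,n\}$. A point of $\mathbb{R}^{2^n-1}$ is called entropic if it is the entropy profile of some such tuple, and almost entropic if it lies in the closure of the set of entropic points. Write $I(A{:}B)=H(A)+H(B)-H(A,B)$, $I(A{:}B|C)=H(A,C)+H(B,C)-H(A,B,C)-H(C)$ and $$\square_{AB,CD}=I(C{:}D|A)+I(C{:}D|B)+I(A{:}B)-I(C{:}D);$$ for an arbitrary point of $\mathbb{R}^{2^n-1}$ these denote the same linear combinations of its coordinates. Theorem. For every distribution $(A,B,C,D,E)$: (I4) if $I(A{:}D|C)=I(A{:}C|D)=0$, then $\square_{AB,CD}+I(A{:}C|E)+I(A{:}E|C)\ge 0$; (I5) if $I(B{:}C|D)=I(C{:}D|B)=0$, then $\square_{AB,CD}+I(B{:}C|E)+I(C{:}E|B)\ge 0$; (I6) if $I(B{:}C|D)=I(C{:}D|B)=0$, then $\square_{AB,CD}+I(C{:}D|E)+I(C{:}E|D)\ge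 0$. Moreover, (I4), (I5) and (I6) hold for all almost entropic points of $\mathbb{R}^{2^5-1}$. Consequently, for every distribution $(A,B,C,D)$: (I4$'$) if $I(A{:}D|C)=I(A{:}C|D)=0$, then $\square_{AB,CD}\ge 0$; (I5$'$) if $I(B{:}C|D)=I(C{:}D|B)=0$, then $\square_{AB,CD}\ge 0$; and (I4$'$) and (I5$'$) hold for all almost entropic points of $\mathbb{R}^{2^4-1}$. -/

import Mathlib

open MeasureTheory

/-- Shannon entropy `H(X) = ∑ₓ p(x) log₂ (1 / p(x))`, in bits, of a random variable `X` with values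
in a finite set, where `p(x) = P[X = x]`. Terms with `p(x) = 0` contribute `0`. -/
noncomputable def shannonEntropy {Ω S : Type*} [MeasurableSpace Ω] [Fintype S]
    (P : Measure Ω) (X : Ω → S) : ℝ :=
  ∑ x : S, P.real (X ⁻¹' {x}) * Real.logb 2 (1 / P.real (X ⁻¹' {x}))

/-- The space `ℝ^(2ⁿ - 1)`, with coordinates indexed by the nonempty sets of indices of variables,
with its usual (product) topology. -/
abbrev EntropySpace (n : ℕ) : Type :=
  {S : Finset (Fin n) // S.Nonempty} → ℝ

/-- The entropy profile of `(X₁, …, Xₙ)`: the vector of the entropies of all nonempty sub-tuples. -/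
noncomputable def entropyProfile {n : ℕ} {Ω : Type*} [MeasurableSpace Ω] (P : Measure Ω)
    {α : Fin n → Type*} [∀ i, Fintype (α i)] (X : ∀ i, Ω → α i) : EntropySpace n :=
  fun S => shannonEntropy P (fun ω => fun i : S.1 => X i ω)

/-- A point is entropic if it is the entropy profile of `n` jointly distributed random variables
with finite ranges. -/
def IsEntropic {n : ℕ} (h : EntropySpace n) : Prop :=
  ∃ (Ω : Type) (_ : MeasurableSpace Ω) (P : Measure Ω) (_ : IsProbabilityMeasure P)
    (α : Fin n → Type) (_ : ∀ i, Fintype (α i)) (_ : ∀ i, MeasurableSpace (α i))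
    (_ : ∀ i, MeasurableSingletonClass (α i)) (X : ∀ i, Ω → α i),
    (∀ i, Measurable (X i)) ∧ h = entropyProfile P X

/-- A point is almost entropic if it lies in the closure of the set of entropic points. -/
def IsAlmostEntropic {n : ℕ} (h : EntropySpace n) : Prop :=
  h ∈ closure {g : EntropySpace n | IsEntropic g}

/-- `I(A:B) = H(A) + H(B) - H(A,B)`, as a linear form in the coordinates of `h`. -/
def mutualInfo {n : ℕ} (h : EntropySpace n) (A B : Fin n) : ℝ :=
  h ⟨{A}, by simp⟩ + h ⟨{B}, by simp⟩ - h ⟨{A, B}, by simp⟩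

/-- `I(A:B|C) = H(A,C) + H(B,C) - H(A,B,C) - H(C)`, as a linear form in the coordinates of `h`. -/
def condMutualInfo {n : ℕ} (h : EntropySpace n) (A B C : Fin n) : ℝ :=
  h ⟨{A, C}, by simp⟩ + h ⟨{B, C}, by simp⟩ - h ⟨{A, B, C}, by simp⟩ - h ⟨{C}, by simp⟩

/-- The Ingleton expression `□_{AB,CD} = I(C:D|A) + I(C:D|B) + I(A:B) - I(C:D)`. -/
def box {n : ℕ} (h : EntropySpace n) (A B C D : Fin n) : ℝ :=
  condMutualInfo h C D A + condMutualInfo h C D B + mutualInfo h A B - mutualInfo h C D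

/-- If `I(A:D|C) = I(A:C|D) = 0` then `□_{AB,CD} + I(A:C|E) + I(A:E|C) ≥ 0`. -/
def InequalityI4 {n : ℕ} (h : EntropySpace n) (A B C D E : Fin n) : Prop :=
  condMutualInfo h A D C = 0 → condMutualInfo h A C D = 0 →
    0 ≤ box h A B C D + condMutualInfo h A C E + condMutualInfo h A E C

/-- If `I(B:C|D) = I(C:D|B) = 0` then `□_{AB,CD} + I(B:C|E) + I(C:E|B) ≥ 0`. -/
def InequalityI5 {n : ℕ} (h : EntropySpace n) (A B C D E : Fin n) : Prop :=
  condMutualInfo h B C D = 0 → condMutualInfo h C D B = 0 →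
    0 ≤ box h A B C D + condMutualInfo h B C E + condMutualInfo h C E B

/-- If `I(B:C|D) = I(C:D|B) = 0` then `□_{AB,CD} + I(C:D|E) + I(C:E|D) ≥ 0`. -/
def InequalityI6 {n : ℕ} (h : EntropySpace n) (A B C D E : Fin n) : Prop :=
  condMutualInfo h B C D = 0 → condMutualInfo h C D B = 0 →
    0 ≤ box h A B C D + condMutualInfo h C D E + condMutualInfo h C E D

/-- If `I(A:D|C) = I(A:C|D) = 0` then `□_{AB,CD} ≥ 0`. -/
def InequalityI4' {n : ℕ} (h : EntropySpace n) (A B C D : Fin n) : Prop :=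
  condMutualInfo h A D C = 0 → condMutualInfo h A C D = 0 → 0 ≤ box h A B C D

/-- If `I(B:C|D) = I(C:D|B) = 0` then `□_{AB,CD} ≥ 0`. -/
def InequalityI5' {n : ℕ} (h : EntropySpace n) (A B C D : Fin n) : Prop :=
  condMutualInfo h B C D = 0 → condMutualInfo h C D B = 0 → 0 ≤ box h A B C D

/-! Each conditional inequality is the limit of unconditional ones. For every `k` one proves `k *
(target) + (one extra term) + k(k-1)/2 * (sum of the two premises) ≥ 0`; when the premises vanish,
dividing by `k` and letting `k → ∞` leaves the target. A conditional inequality need not survive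
closure, since approximating entropic points need not satisfy its premises; the unconditional ones
are closed conditions and do survive.

The family is proved by induction on `k`. For (I4), replace `E` by a copy `E'` with the same joint
law with `(A, C)` and independent of `(B, D)` given `(A, C)`. Submodularity then gives `I(D:E'|A) ≤
□ + I(A:C|E) + I(A:E|C) + I(C:E|A)` and `I(A:D|E') + I(A:E'|D) ≤ I(A:C|E) + I(A:E|C) + I(A:D|C) +
I(A:C|D)`. Insert these, the second `k` times, into case `k` with `C` and `D` exchanged, a symmetry
of `□`: the result is case `k + 1`. For (I5) and (I6) the exchange is of `B` and `D`. It is not a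
symmetry of `□` but preserves the sum of the premises, so each family feeds the other and the
induction is simultaneous. -/

/-! ### Entropy of functions on a finite weighted set. -/

section FiniteEntropy

open scoped Classical in
/-- The mass, under the weights `p`, of the fibre of `f` through `ω`. -/
noncomputable def fiberMass {Ω T : Type*} [Fintype Ω] (p : Ω → ℝ) (f : Ω → T) (ω : Ω) : ℝ :=
  ∑ ω', if f ω' = f ω then p ω' else 0

/-- Shannon entropy, in bits, of a function on a finite set with weights `p`. -/
noncomputable def weightEntropy {Ω T : Type*} [Fintype Ω] (p : Ω → ℝ) (f : Ω → T) : ℝ :=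
  -∑ ω, p ω * Real.logb 2 (fiberMass p f ω)

variable {Ω : Type*} [Fintype Ω] {p : Ω → ℝ}

theorem fiberMass_congr {T : Type*} {f : Ω → T} {ω ω' : Ω} (h : f ω = f ω') :
    fiberMass p f ω = fiberMass p f ω' := by
  unfold fiberMass
  refine Finset.sum_congr rfl fun a _ => ?_
  rw [h]

theorem fiberMass_eq_sum {T : Type*} [DecidableEq T] (f : Ω → T) (ω : Ω) :
    fiberMass p f ω = ∑ ω', if f ω' = f ω then p ω' else 0 := by
  unfold fiberMass
  exact Finset.sum_congr rfl fun _ _ => by congr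

theorem le_fiberMass {T : Type*} (hp : ∀ ω, 0 ≤ p ω) (f : Ω → T) (ω : Ω) :
    p ω ≤ fiberMass p f ω := by
  classical
  unfold fiberMass
  refine le_trans ?_ (Finset.single_le_sum (f := fun ω' => if f ω' = f ω then p ω' else 0)
    (fun i _ => ?_) (Finset.mem_univ ω))
  · simp
  · split_ifs <;> simp [hp]

theorem fiberMass_pos {T : Type*} (hp : ∀ ω, 0 ≤ p ω) (f : Ω → T) {ω : Ω} (hω : p ω ≠ 0) :
    0 < fiberMass p f ω :=
  lt_of_lt_of_le (lt_of_le_of_ne (hp ω) hω.symm) (le_fiberMass hp f ω)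

/-- Entropy depends only on the partition into fibres, up to null sets. -/
theorem weightEntropy_congr {T T' : Type*} {f : Ω → T} {g : Ω → T'}
    (h : ∀ ω ω', p ω ≠ 0 → p ω' ≠ 0 → (f ω' = f ω ↔ g ω' = g ω)) :
    weightEntropy p f = weightEntropy p g := by
  classical
  unfold weightEntropy
  congr 1
  refine Finset.sum_congr rfl fun ω _ => ?_
  by_cases hω : p ω = 0
  · simp [hω]
  congr 2
  unfold fiberMass
  refine Finset.sum_congr rfl fun ω' _ => ?_
  by_cases hω' : p ω' = 0
  · simp [hω']
  · simp only [h ω ω' hω hω']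

/-- Transport of entropy along a map onto which the weights push forward. -/
theorem weightEntropy_comp {Ω' T : Type*} [Fintype Ω'] {q : Ω' → ℝ} [DecidableEq Ω] {φ : Ω' → Ω}
    (h : ∀ ω, ∑ ω', (if φ ω' = ω then q ω' else 0) = p ω) (f : Ω → T) :
    weightEntropy q (f ∘ φ) = weightEntropy p f := by
  classical
  have key (F : Ω → ℝ) : ∑ ω', q ω' * F (φ ω') = ∑ ω, p ω * F ω := by
    simp_rw [← h, Finset.sum_mul]
    rw [Finset.sum_comm]
    refine Finset.sum_congr rfl fun ω' _ => ?_
    simp [ite_mul]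
  unfold weightEntropy
  rw [← key]
  congr 1
  refine Finset.sum_congr rfl fun ω' _ => ?_
  congr 2
  unfold fiberMass
  have := key fun ω => if f ω = f (φ ω') then 1 else 0
  simpa using this

theorem weightEntropy_eq_sum {T : Type*} [Fintype T] [DecidableEq T] (f : Ω → T) :
    weightEntropy p f =
      -∑ t, (∑ ω, if f ω = t then p ω else 0) *
        Real.logb 2 (∑ ω, if f ω = t then p ω else 0) := by
  have h := weightEntropy_comp (q := p) (φ := f) (p := fun t => ∑ ω, if f ω = t then p ω else 0)
    (fun t => rfl) (id : T → T)
  have h2 : ∀ t, fiberMass (fun t => ∑ ω, if f ω = t then p ω else 0) (id : T → T) t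
      = ∑ ω, if f ω = t then p ω else 0 := by
    intro t; unfold fiberMass; simp
  rw [show f = id ∘ f from rfl, h]
  unfold weightEntropy
  simp_rw [h2]; rfl

/-- Strong subadditivity of entropy, when `h` is a function of `f` and of `g`. -/
theorem weightEntropy_submodular {T₁ T₂ T₃ : Type*} (hp : ∀ ω, 0 ≤ p ω)
    (f : Ω → T₁) (g : Ω → T₂) (h : Ω → T₃)
    (hf : ∀ ω ω', f ω = f ω' → h ω = h ω') (hg : ∀ ω ω', g ω = g ω' → h ω = h ω') :
    weightEntropy p (fun ω => (f ω, g ω)) + weightEntropy p h ≤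
      weightEntropy p f + weightEntropy p g := by
  classical
  set j : Ω → T₁ × T₂ := fun ω => (f ω, g ω) with hj
  -- The difference of the two sides is `-∑ p log₂ R`, so `log R ≤ R - 1` reduces the claim to `∑ p
  -- R ≤ ∑ p`; the total weight need not be `1`.
  set R : Ω → ℝ := fun ω => fiberMass p f ω * fiberMass p g ω /
    (fiberMass p j ω * fiberMass p h ω) with hR
  have hbound : ∀ ω, p ω * (Real.logb 2 (fiberMass p f ω) + Real.logb 2 (fiberMass p g ω)
      - Real.logb 2 (fiberMass p j ω) - Real.logb 2 (fiberMass p h ω)) ≤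
      (p ω * R ω - p ω) / Real.log 2 := by
    intro ω
    by_cases hω : p ω = 0
    · simp [hω]
    have h1 := fiberMass_pos hp f hω
    have h2 := fiberMass_pos hp g hω
    have h3 := fiberMass_pos hp j hω
    have h4 := fiberMass_pos hp h hω
    have hl : Real.log (R ω) ≤ R ω - 1 := Real.log_le_sub_one_of_pos (by positivity)
    have he : Real.log (R ω) = Real.log (fiberMass p f ω) + Real.log (fiberMass p g ω)
      - Real.log (fiberMass p j ω) - Real.log (fiberMass p h ω) := by
      simp only [hR]
      rw [Real.log_div (by positivity) (by positivity), Real.log_mul h1.ne' h2.ne',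
        Real.log_mul h3.ne' h4.ne']
      ring
    have : p ω * (Real.logb 2 (fiberMass p f ω) + Real.logb 2 (fiberMass p g ω)
      - Real.logb 2 (fiberMass p j ω) - Real.logb 2 (fiberMass p h ω)) =
        p ω * Real.log (R ω) / Real.log 2 := by
      rw [he]; simp only [Real.logb]; ring
    rw [this]
    have hlog : 0 < Real.log 2 := Real.log_pos (by norm_num)
    gcongr
    nlinarith [mul_le_mul_of_nonneg_left hl (hp ω)]
  have hsum : ∑ ω, p ω * R ω ≤ ∑ ω, p ω := by
    -- The `ω` that contribute form a single joint fibre, on which the denominator is constant;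
    -- summing `p` over it cancels the joint mass.
    have hinner (a b : Ω) : ∑ ω, (if f a = f ω ∧ g b = g ω then
        p ω / (fiberMass p j ω * fiberMass p h ω) else 0) ≤
        if h b = h a then 1 / fiberMass p h a else 0 := by
      by_cases hex : ∃ ω₀, f a = f ω₀ ∧ g b = g ω₀
      · obtain ⟨ω₀, h1, h2⟩ := hex
        have hab : h b = h a := (hg _ _ h2).trans (hf _ _ h1).symm
        rw [if_pos hab]
        have hterm (ω : Ω) : (if f a = f ω ∧ g b = g ω then
            p ω / (fiberMass p j ω * fiberMass p h ω) else 0) =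
            (if j ω = j ω₀ then p ω else 0) / (fiberMass p j ω₀ * fiberMass p h a) := by
          by_cases hω : j ω = j ω₀
          · have hω' := Prod.ext_iff.1 hω
            have hha : h ω = h a := hf _ _ (hω'.1.trans h1.symm)
            rw [if_pos hω, if_pos ⟨h1.trans hω'.1.symm, h2.trans hω'.2.symm⟩]
            rw [fiberMass_congr hω, fiberMass_congr hha]
          · rw [if_neg hω, if_neg, zero_div]
            rintro ⟨h3, h4⟩
            exact hω (Prod.ext (h3.symm.trans h1) (h4.symm.trans h2))
        simp_rw [hterm]
        rw [← Finset.sum_div]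
        rw [← fiberMass_eq_sum, ← div_div]
        gcongr
        · exact (hp a).trans (le_fiberMass hp h a)
        · exact div_self_le_one _
      · push Not at hex
        rw [Finset.sum_eq_zero]
        · split_ifs
          · exact one_div_nonneg.2 ((hp a).trans (le_fiberMass hp h a))
          · exact le_rfl
        · intro ω _
          rw [if_neg]
          rintro ⟨h1, h2⟩
          exact hex ω h1 h2
    calc ∑ ω, p ω * R ω
        = ∑ a, ∑ b, p a * p b * ∑ ω, (if f a = f ω ∧ g b = g ω then
            p ω / (fiberMass p j ω * fiberMass p h ω) else 0) := by
          simp_rw [Finset.mul_sum]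
          rw [Finset.sum_congr rfl fun a _ => Finset.sum_comm, Finset.sum_comm]
          refine Finset.sum_congr rfl fun ω _ => ?_
          have : p ω * R ω = (p ω / (fiberMass p j ω * fiberMass p h ω)) *
              (fiberMass p f ω * fiberMass p g ω) := by
            simp only [hR]; ring
          rw [this]
          rw [fiberMass_eq_sum f, fiberMass_eq_sum g, Finset.sum_mul_sum, Finset.mul_sum]
          refine Finset.sum_congr rfl fun a _ => ?_
          rw [Finset.mul_sum]
          refine Finset.sum_congr rfl fun b _ => ?_
          by_cases h1 : f a = f ω <;> by_cases h2 : g b = g ω <;> simp [h1, h2]; ring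
      _ ≤ ∑ a, ∑ b, p a * p b * (if h b = h a then 1 / fiberMass p h a else 0) := by
          gcongr with a _ b _
          · exact mul_nonneg (hp a) (hp b)
          · exact hinner a b
      _ = ∑ a, p a * (fiberMass p h a / fiberMass p h a) := by
          refine Finset.sum_congr rfl fun a _ => ?_
          conv_rhs => rw [div_eq_mul_inv]; enter [2, 1]; rw [fiberMass_eq_sum]
          rw [Finset.sum_mul, Finset.mul_sum]
          refine Finset.sum_congr rfl fun b _ => ?_
          by_cases h1 : h b = h a <;> simp [h1]; ring
      _ ≤ ∑ a, p a := by
          gcongr with a _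
          exact mul_le_of_le_one_right (hp a) (div_self_le_one _)
  have := Finset.sum_le_sum fun ω (_ : ω ∈ Finset.univ) => hbound ω
  rw [← Finset.sum_div, Finset.sum_sub_distrib] at this
  have h0 : (∑ ω, p ω * R ω - ∑ ω, p ω) / Real.log 2 ≤ 0 :=
    div_nonpos_of_nonpos_of_nonneg (by linarith) (Real.log_nonneg (by norm_num))
  simp only [mul_sub, mul_add, Finset.sum_sub_distrib, Finset.sum_add_distrib] at this
  unfold weightEntropy
  linarith

end FiniteEntropy

/-! ### Conditionally independent copies. -/

section ConditionalCopy

variable {Ω : Type*} [Fintype Ω] {p : Ω → ℝ} {T : Type*}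

open scoped Classical in
/-- Weights on pairs `(ω, ω')` for which both components have weights `p`, agree on `z`, and are
conditionally independent given `z`. -/
noncomputable def conditionalCopy (p : Ω → ℝ) (z : Ω → T) (ω : Ω × Ω) : ℝ :=
  if z ω.2 = z ω.1 then p ω.1 * p ω.2 / fiberMass p z ω.1 else 0

theorem conditionalCopy_nonneg (hp : ∀ ω, 0 ≤ p ω) (z : Ω → T) (ω : Ω × Ω) :
    0 ≤ conditionalCopy p z ω := by
  unfold conditionalCopy
  split_ifs
  · exact div_nonneg (mul_nonneg (hp _) (hp _)) ((hp _).trans (le_fiberMass hp z _))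
  · exact le_rfl

theorem conditionalCopy_ne_zero {z : Ω → T} {ω : Ω × Ω} (h : conditionalCopy p z ω ≠ 0) :
    z ω.2 = z ω.1 ∧ p ω.1 ≠ 0 ∧ p ω.2 ≠ 0 := by
  unfold conditionalCopy at h
  split_ifs at h with hz
  · refine ⟨hz, fun h0 => ?_, fun h0 => ?_⟩ <;> simp [h0] at h
  · simp at h

theorem conditionalCopy_swap (z : Ω → T) (a b : Ω) :
    conditionalCopy p z (a, b) = conditionalCopy p z (b, a) := by
  unfold conditionalCopy
  by_cases h : z b = z a
  · simp only [h, if_true, fiberMass_congr (p := p) h]; ring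
  · simp only [h, Ne.symm h, if_false]

theorem sum_conditionalCopy (hp : ∀ ω, 0 ≤ p ω) (z : Ω → T) (a : Ω) :
    ∑ b, conditionalCopy p z (a, b) = p a := by
  classical
  by_cases ha : p a = 0
  · simp [conditionalCopy, ha]
  have h := fiberMass_pos hp z ha
  have : ∀ b, conditionalCopy p z (a, b) =
      p a / fiberMass p z a * (if z b = z a then p b else 0) := by
    intro b; unfold conditionalCopy; split_ifs <;> simp; ring
  simp_rw [this]
  rw [← Finset.mul_sum, ← fiberMass_eq_sum]
  field_simp

theorem sum_conditionalCopy_fst (hp : ∀ ω, 0 ≤ p ω) (z : Ω → T) (P : Ω → Prop)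
    [DecidablePred P] : ∑ ω : Ω × Ω, (if P ω.1 then conditionalCopy p z ω else 0) =
      ∑ a, if P a then p a else 0 := by
  rw [Fintype.sum_prod_type]
  refine Finset.sum_congr rfl fun a _ => ?_
  by_cases h : P a <;> simp [h, sum_conditionalCopy hp]

theorem sum_conditionalCopy_snd (hp : ∀ ω, 0 ≤ p ω) (z : Ω → T) (P : Ω → Prop)
    [DecidablePred P] : ∑ ω : Ω × Ω, (if P ω.2 then conditionalCopy p z ω else 0) =
      ∑ a, if P a then p a else 0 := by
  rw [Fintype.sum_prod_type, Finset.sum_comm]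
  refine Finset.sum_congr rfl fun b _ => ?_
  by_cases h : P b <;> simp [h, conditionalCopy_swap z _ b, sum_conditionalCopy hp]

theorem weightEntropy_conditionalCopy_fst (hp : ∀ ω, 0 ≤ p ω) (z : Ω → T) {T' : Type*}
    (f : Ω → T') : weightEntropy (conditionalCopy p z) (fun ω => f ω.1) = weightEntropy p f := by
  classical
  refine weightEntropy_comp (φ := Prod.fst) (fun a => ?_) f
  simp [sum_conditionalCopy_fst hp z (· = a)]

theorem weightEntropy_conditionalCopy_snd (hp : ∀ ω, 0 ≤ p ω) (z : Ω → T) {T' : Type*}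
    (f : Ω → T') : weightEntropy (conditionalCopy p z) (fun ω => f ω.2) = weightEntropy p f := by
  classical
  refine weightEntropy_comp (φ := Prod.snd) (fun b => ?_) f
  simp [sum_conditionalCopy_snd hp z (· = b)]

/-- Conditional independence of the two components of the conditional copy. -/
theorem weightEntropy_conditionalCopy_pair (hp : ∀ ω, 0 ≤ p ω) {z : Ω → T} {T₁ T₂ : Type*}
    {f : Ω → T₁} {g : Ω → T₂} (hf : ∀ ω ω', f ω = f ω' → z ω = z ω')
    (hg : ∀ ω ω', g ω = g ω' → z ω = z ω') :
    weightEntropy (conditionalCopy p z) (fun ω => (f ω.1, g ω.2)) =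
      weightEntropy p f + weightEntropy p g - weightEntropy p z := by
  classical
  rw [← weightEntropy_conditionalCopy_fst hp z f, ← weightEntropy_conditionalCopy_snd hp z g,
    ← weightEntropy_conditionalCopy_fst hp z z]
  have hf₁ (ω : Ω × Ω) : fiberMass (conditionalCopy p z) (fun ω => f ω.1) ω = fiberMass p f ω.1 :=
    sum_conditionalCopy_fst hp z (f · = f ω.1)
  have hz₁ (ω : Ω × Ω) : fiberMass (conditionalCopy p z) (fun ω => z ω.1) ω = fiberMass p z ω.1 :=
    sum_conditionalCopy_fst hp z (z · = z ω.1)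
  have hg₂ (ω : Ω × Ω) : fiberMass (conditionalCopy p z) (fun ω => g ω.2) ω = fiberMass p g ω.2 :=
    sum_conditionalCopy_snd hp z (g · = g ω.2)
  -- Since `f` and `g` determine `z`, the constraint on `z` holds throughout this fibre and the
  -- denominator is constant there, so the double sum factorises.
  have hpair (ω : Ω × Ω) (hω : conditionalCopy p z ω ≠ 0) :
      fiberMass (conditionalCopy p z) (fun ω => (f ω.1, g ω.2)) ω =
        fiberMass p f ω.1 * fiberMass p g ω.2 / fiberMass p z ω.1 := by
    unfold fiberMass
    rw [Fintype.sum_prod_type, Finset.sum_mul_sum, Finset.sum_div]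
    refine Finset.sum_congr rfl fun a _ => ?_
    rw [Finset.sum_div]
    refine Finset.sum_congr rfl fun b _ => ?_
    by_cases h1 : f a = f ω.1 <;> by_cases h2 : g b = g ω.2 <;> simp [h1, h2]
    have hza := hf _ _ h1
    have hzb := hg _ _ h2
    have hz := (conditionalCopy_ne_zero hω).1
    unfold conditionalCopy
    rw [if_pos (hzb.trans (hz.trans hza.symm))]
    simp only [fiberMass, hza]
  unfold weightEntropy
  simp only [← Finset.sum_neg_distrib, ← Finset.sum_add_distrib, ← Finset.sum_sub_distrib]
  refine Finset.sum_congr rfl fun ω _ => ?_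
  by_cases hω : conditionalCopy p z ω = 0
  · simp [hω]
  obtain ⟨-, h1, h2⟩ := conditionalCopy_ne_zero hω
  rw [hpair ω hω, hf₁, hg₂, hz₁, Real.logb_div, Real.logb_mul]
  · ring
  all_goals simp [(fiberMass_pos hp _ h1).ne', (fiberMass_pos hp _ h2).ne']

end ConditionalCopy

-- Entropy as a set function, and the copy lemma.

universe u

/-- The set function `S ↦ H(X_S)` of a tuple of functions on a finite set with nonnegative
weights (the total weight plays no role in the inequalities below). -/
def IsEntropyFunction {n : ℕ} (h : Finset (Fin n) → ℝ) : Prop :=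
  ∃ (Ω : Type u) (_ : Fintype Ω) (p : Ω → ℝ) (α : Fin n → Type u) (X : ∀ i, Ω → α i),
    (∀ ω, 0 ≤ p ω) ∧ ∀ S, h S = weightEntropy p (fun ω => fun i : S => X i ω)

namespace IsEntropyFunction

variable {n : ℕ} {h : Finset (Fin n) → ℝ}

/-- The source of every Shannon inequality used below. `U` and `V` are free so that literal sets can
be supplied and the identities left to `decide`. -/
theorem submodular (hh : IsEntropyFunction.{u} h) {S T U V : Finset (Fin n)} (hU : S ∪ T = U)
    (hV : S ∩ T = V) : h U + h V ≤ h S + h T := by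
  obtain ⟨Ω, _, p, α, X, hp, hX⟩ := hh
  subst hU hV
  simp only [hX]
  have := weightEntropy_submodular hp (fun ω => fun i : S => X i ω) (fun ω => fun i : T => X i ω)
    (fun ω => fun i : (S ∩ T : Finset (Fin n)) => X i ω)
    (fun ω ω' h => by
      funext i; exact congrFun h ⟨i, (Finset.mem_inter.1 i.2).1⟩)
    (fun ω ω' h => by
      funext i; exact congrFun h ⟨i, (Finset.mem_inter.1 i.2).2⟩)
  refine le_trans (le_of_eq ?_) this
  congr 1
  refine weightEntropy_congr fun ω ω' _ _ => ?_
  simp only [funext_iff, Prod.ext_iff, Subtype.forall, Finset.mem_union]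
  grind

/-- The map `e` need not be injective: it serves both to exchange two variables and to duplicate
one. -/
theorem comap (hh : IsEntropyFunction.{u} h) {m : ℕ} (e : Fin m → Fin n) :
    IsEntropyFunction.{u} fun S => h (S.image e) := by
  obtain ⟨Ω, _, p, α, X, hp, hX⟩ := hh
  refine ⟨Ω, ‹_›, p, fun i => α (e i), fun i => X (e i), hp, fun S => ?_⟩
  simp only [hX]
  refine weightEntropy_congr fun ω ω' _ _ => ?_
  simp only [funext_iff, Subtype.forall, Finset.mem_image]
  grind

/-- The copy lemma: the variable `e` can be replaced by a copy with the same distribution jointly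
with the variables in `K`, and conditionally independent of all the others given these. -/
theorem exists_copy (hh : IsEntropyFunction.{u} h) (e : Fin n) {K L : Finset (Fin n)}
    (hL : insert e K = L) :
    ∃ g : Finset (Fin n) → ℝ, IsEntropyFunction.{u} g ∧ (∀ S, e ∉ S → g S = h S) ∧
      (∀ S, S ⊆ L → g S = h S) ∧
      ∀ S U, e ∉ S → K ⊆ S → insert e S = U → g U = h S + h L - h K := by
  classical
  subst hL
  obtain ⟨Ω, _, p, α, X, hp, hX⟩ := hh
  set z : Ω → ∀ i : K, α i := fun ω i => X i ω with hz
  let Y : ∀ i, Ω × Ω → α i := fun i ω => if i = e then X i ω.2 else X i ω.1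
  refine ⟨fun S => weightEntropy (conditionalCopy p z) (fun ω => fun i : S => Y i ω),
    ⟨Ω × Ω, inferInstance, conditionalCopy p z, α, Y, conditionalCopy_nonneg hp z,
      fun S => rfl⟩, fun S hS => ?_, fun S hS => ?_,
    fun S U hS hK hU => ?_⟩
  · rw [hX, ← weightEntropy_conditionalCopy_fst hp z]
    refine weightEntropy_congr fun ω ω' _ _ => ?_
    have : ∀ i : S, (i : Fin n) ≠ e := fun i hi => hS (hi ▸ i.2)
    simp [funext_iff, Y, this]
  -- The variables in `K` agree on both components almost surely, so this tuple may be read off the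
  -- second component alone.
  · rw [hX, ← weightEntropy_conditionalCopy_snd hp z]
    refine weightEntropy_congr fun ω ω' h1 h2 => ?_
    have h1 := (conditionalCopy_ne_zero h1).1
    have h2 := (conditionalCopy_ne_zero h2).1
    simp only [hz, funext_iff, Subtype.forall] at h1 h2
    simp only [funext_iff, Y, Subtype.forall]
    grind
  · subst hU
    rw [hX, hX, hX, ← weightEntropy_conditionalCopy_pair hp (z := z)]
    · refine weightEntropy_congr fun ω ω' h1 h2 => ?_
      have h1 := (conditionalCopy_ne_zero h1).1
      have h2 := (conditionalCopy_ne_zero h2).1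
      simp only [hz, funext_iff, Subtype.forall] at h1 h2
      simp only [funext_iff, Y, Subtype.forall, Prod.ext_iff]
      grind
    · intro ω ω' h; funext i; exact congrFun h ⟨i, hK i.2⟩
    · intro ω ω' h; funext i; exact congrFun h ⟨i, Finset.mem_insert_of_mem i.2⟩

end IsEntropyFunction

/-- Reordering of the sets of variables that occur in the inequalities below. -/
theorem finset_sort :
    ({2, 0} : Finset (Fin 5)) = {0, 2} ∧
    ({2, 1} : Finset (Fin 5)) = {1, 2} ∧
    ({3, 0} : Finset (Fin 5)) = {0, 3} ∧
    ({3, 1} : Finset (Fin 5)) = {1, 3} ∧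
    ({3, 2} : Finset (Fin 5)) = {2, 3} ∧
    ({4, 0} : Finset (Fin 5)) = {0, 4} ∧
    ({4, 1} : Finset (Fin 5)) = {1, 4} ∧
    ({4, 2} : Finset (Fin 5)) = {2, 4} ∧
    ({4, 3} : Finset (Fin 5)) = {3, 4} ∧
    ({2, 0, 3} : Finset (Fin 5)) = {0, 2, 3} ∧
    ({2, 0, 4} : Finset (Fin 5)) = {0, 2, 4} ∧
    ({2, 1, 3} : Finset (Fin 5)) = {1, 2, 3} ∧
    ({2, 1, 4} : Finset (Fin 5)) = {1, 2, 4} ∧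
    ({3, 0, 2} : Finset (Fin 5)) = {0, 2, 3} ∧
    ({3, 0, 4} : Finset (Fin 5)) = {0, 3, 4} ∧
    ({3, 1, 2} : Finset (Fin 5)) = {1, 2, 3} ∧
    ({3, 2, 4} : Finset (Fin 5)) = {2, 3, 4} := by
  decide

/-- The point of `ℝ^(2ⁿ - 1)` given by a set function. -/
def EntropySpace.ofSetFunction {n : ℕ} (h : Finset (Fin n) → ℝ) : EntropySpace n := fun S => h S

/-- An unconditional inequality, for each `k`, with (I4) as its limit. -/
def FamilyI4 {n : ℕ} (k : ℕ) (h : EntropySpace n) (A B C D E : Fin n) : Prop :=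
  0 ≤ k * (box h A B C D + condMutualInfo h A C E + condMutualInfo h A E C) +
    condMutualInfo h C E A + k * (k - 1) / 2 * (condMutualInfo h A D C + condMutualInfo h A C D)

/-- An unconditional inequality, for each `k`, with (I5) as its limit. -/
def FamilyI5 {n : ℕ} (k : ℕ) (h : EntropySpace n) (A B C D E : Fin n) : Prop :=
  0 ≤ k * (box h A B C D + condMutualInfo h B C E + condMutualInfo h C E B) +
    condMutualInfo h B E C + k * (k - 1) / 2 * (condMutualInfo h B C D + condMutualInfo h C D B)

/-- An unconditional inequality, for each `k`, with (I6) as its limit. -/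
def FamilyI6 {n : ℕ} (k : ℕ) (h : EntropySpace n) (A B C D E : Fin n) : Prop :=
  0 ≤ k * (box h A B C D + condMutualInfo h C D E + condMutualInfo h C E D) +
    condMutualInfo h D E C + k * (k - 1) / 2 * (condMutualInfo h B C D + condMutualInfo h C D B)

open EntropySpace

/-! ### Induction on `k` for the unconditional families. -/

section Family

variable {h : Finset (Fin 5) → ℝ}

theorem IsEntropyFunction.familyI4 (hh : IsEntropyFunction.{u} h) (k : ℕ) :
    FamilyI4 k (ofSetFunction h) 0 1 2 3 4 := by
  induction k generalizing h with
  | zero =>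
    have s0 := hh.submodular (S := {0, 2}) (T := {0, 4}) (U := {0, 2, 4}) (V := {0})
      (by decide) (by decide)
    simp only [FamilyI4, box, mutualInfo, condMutualInfo, ofSetFunction, finset_sort]
    push_cast
    linarith
  | succ k ih =>
    obtain ⟨g, hg, h1, h2, h3⟩ := hh.exists_copy 4 (K := {0, 2}) (L := {0, 2, 4}) (by decide)
    have c2 := h3 {0, 2, 3} {0, 2, 3, 4} (by decide) (by decide) (by decide)
    have c3 := h3 {0, 1, 2, 3} {0, 1, 2, 3, 4} (by decide) (by decide) (by decide)
    have s1 := hg.submodular (S := {0, 4}) (T := {1, 4}) (U := {0, 1, 4}) (V := {4})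
      (by decide) (by decide)
    have s2 := hg.submodular (S := {0, 3, 4}) (T := {2, 3, 4}) (U := {0, 2, 3, 4}) (V := {3, 4})
      (by decide) (by decide)
    have s3 := hg.submodular (S := {1, 2}) (T := {2, 4}) (U := {1, 2, 4}) (V := {2})
      (by decide) (by decide)
    have s4 := hg.submodular (S := {1, 3}) (T := {3, 4}) (U := {1, 3, 4}) (V := {3})
      (by decide) (by decide)
    have s5 := hg.submodular (S := {2, 3}) (T := {2, 4}) (U := {2, 3, 4}) (V := {2})
      (by decide) (by decide)
    have s6 := hg.submodular (S := {1, 2, 4}) (T := {1, 3, 4}) (U := {1, 2, 3, 4}) (V := {1, 4})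
      (by decide) (by decide)
    have s7 := hg.submodular (S := {0, 1, 2, 3}) (T := {0, 1, 4})
      (U := {0, 1, 2, 3, 4}) (V := {0, 1}) (by decide) (by decide)
    have s8 := hg.submodular (S := {0, 1, 2, 3}) (T := {1, 2, 3, 4})
      (U := {0, 1, 2, 3, 4}) (V := {1, 2, 3}) (by decide) (by decide)
    -- The induction hypothesis for the copy, with `C` and `D` exchanged.
    have hk := ih (hg.comap ![0, 1, 3, 2, 4])
    simp only [FamilyI4, box, mutualInfo, condMutualInfo, ofSetFunction, Finset.image_insert,
      Finset.image_singleton, Matrix.cons_val, finset_sort] at hk ⊢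
    simp +decide only [c2, c3, h1, h2] at hk s1 s2 s3 s4 s5 s6 s7 s8
    push_cast
    -- `I(A:C|D,E')` and `I(D:E'|C)` are each needed twice in every one of the `k` comparisons of
    -- the target terms, and once more in the bound on `I(D:E'|A)`.
    have hk0 : (0 : ℝ) ≤ 2 * k + 1 := by positivity
    linarith [s1, mul_nonneg hk0 (sub_nonneg.2 s2),
      s3, s4, mul_nonneg hk0 (sub_nonneg.2 s5), s6, s7, s8]

theorem IsEntropyFunction.familyI5_and_familyI6 (hh : IsEntropyFunction.{u} h) (k : ℕ) :
    FamilyI5 k (ofSetFunction h) 0 1 2 3 4 ∧ FamilyI6 k (ofSetFunction h) 0 1 2 3 4 := by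
  induction k generalizing h with
  | zero =>
    constructor
    · have s0 := hh.submodular (S := {1, 2}) (T := {2, 4}) (U := {1, 2, 4}) (V := {2})
        (by decide) (by decide)
      simp only [FamilyI5, box, mutualInfo, condMutualInfo, ofSetFunction, finset_sort]
      push_cast
      linarith
    · have s0 := hh.submodular (S := {2, 3}) (T := {2, 4}) (U := {2, 3, 4}) (V := {2})
        (by decide) (by decide)
      simp only [FamilyI6, box, mutualInfo, condMutualInfo, ofSetFunction, finset_sort]
      push_cast
      linarith
  | succ k ih =>
    constructor
    · obtain ⟨g, hg, h1, h2, h3⟩ := hh.exists_copy 4 (K := {1, 2}) (L := {1, 2, 4}) (by decide)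
      have c2 := h3 {1, 2, 3} {1, 2, 3, 4} (by decide) (by decide) (by decide)
      have c3 := h3 {0, 1, 2, 3} {0, 1, 2, 3, 4} (by decide) (by decide) (by decide)
      have s1 := hg.submodular (S := {0, 4}) (T := {1, 4}) (U := {0, 1, 4}) (V := {4})
        (by decide) (by decide)
      have s2 := hg.submodular (S := {0, 2}) (T := {2, 4}) (U := {0, 2, 4}) (V := {2})
        (by decide) (by decide)
      have s3 := hg.submodular (S := {0, 3}) (T := {3, 4}) (U := {0, 3, 4}) (V := {3})
        (by decide) (by decide)
      have s4 := hg.submodular (S := {1, 3, 4}) (T := {2, 3, 4}) (U := {1, 2, 3, 4}) (V := {3, 4})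
        (by decide) (by decide)
      have s5 := hg.submodular (S := {0, 2, 4}) (T := {0, 3, 4}) (U := {0, 2, 3, 4}) (V := {0, 4})
        (by decide) (by decide)
      have s6 := hg.submodular (S := {1, 3}) (T := {1, 4}) (U := {1, 3, 4}) (V := {1})
        (by decide) (by decide)
      have s7 := hg.submodular (S := {0, 1, 2, 3}) (T := {0, 1, 4})
        (U := {0, 1, 2, 3, 4}) (V := {0, 1}) (by decide) (by decide)
      have s8 := hg.submodular (S := {0, 1, 2, 3}) (T := {0, 2, 3, 4})
        (U := {0, 1, 2, 3, 4}) (V := {0, 2, 3}) (by decide) (by decide)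
      -- Case `k` of (I6) for the copy over `(B, C)`; its extra term `I(D:E'|C)` is bounded by the
      -- target of (I5) plus `I(B:E|C)`.
      have hk := (ih hg).2
      simp only [FamilyI5, FamilyI6, box, mutualInfo, condMutualInfo, ofSetFunction,
        finset_sort] at hk ⊢
      simp +decide only [c2, c3, h1, h2] at hk s1 s2 s3 s4 s5 s6 s7 s8
      push_cast
      have hk0 : (0 : ℝ) ≤ 2 * k + 1 := by positivity
      linarith [s1, s2, s3, mul_nonneg hk0 (sub_nonneg.2 s4),
        s5, mul_nonneg hk0 (sub_nonneg.2 s6), s7, s8]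
    · obtain ⟨g, hg, h1, h2, h3⟩ := hh.exists_copy 4 (K := {2, 3}) (L := {2, 3, 4}) (by decide)
      have c1 := h3 {0, 2, 3} {0, 2, 3, 4} (by decide) (by decide) (by decide)
      have c2 := h3 {1, 2, 3} {1, 2, 3, 4} (by decide) (by decide) (by decide)
      have c3 := h3 {0, 1, 2, 3} {0, 1, 2, 3, 4} (by decide) (by decide) (by decide)
      have s1 := hg.submodular (S := {0, 4}) (T := {1, 4}) (U := {0, 1, 4}) (V := {4})
        (by decide) (by decide)
      have s2 := hg.submodular (S := {0, 2}) (T := {2, 4}) (U := {0, 2, 4}) (V := {2})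
        (by decide) (by decide)
      have s3 := hg.submodular (S := {0, 3}) (T := {3, 4}) (U := {0, 3, 4}) (V := {3})
        (by decide) (by decide)
      have s4 := hg.submodular (S := {1, 3}) (T := {3, 4}) (U := {1, 3, 4}) (V := {3})
        (by decide) (by decide)
      have s5 := hg.submodular (S := {0, 2, 4}) (T := {0, 3, 4}) (U := {0, 2, 3, 4}) (V := {0, 4})
        (by decide) (by decide)
      have s6 := hg.submodular (S := {1, 2, 4}) (T := {1, 3, 4}) (U := {1, 2, 3, 4}) (V := {1, 4})
        (by decide) (by decide)
      have s7 := hg.submodular (S := {0, 1, 2, 3}) (T := {0, 1, 4})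
        (U := {0, 1, 2, 3, 4}) (V := {0, 1}) (by decide) (by decide)
      -- Case `k` of (I5) for the copy over `(C, D)`; its extra term `I(B:E'|C)` is bounded by the
      -- target of (I6) plus `I(D:E|C)`.
      have hk := (ih hg).1
      simp only [FamilyI5, FamilyI6, box, mutualInfo, condMutualInfo, ofSetFunction,
        finset_sort] at hk ⊢
      simp +decide only [c1, c2, c3, h1, h2] at hk s1 s2 s3 s4 s5 s6 s7
      push_cast
      have hk0 : (0 : ℝ) ≤ 2 * k + 1 := by positivity
      linarith [s1, s2, s3, mul_nonneg hk0 (sub_nonneg.2 s4),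
        s5, mul_nonneg hk0 (sub_nonneg.2 s6), s7]

end Family

/-! ### Transfer to random variables, closure and limit. -/

/-- The finite model is the joint law on the product of the ranges, with the coordinate projections
as variables. -/
theorem entropyProfile_eq_ofSetFunction {n : ℕ} {Ω : Type*} [MeasurableSpace Ω] (P : Measure Ω)
    [IsProbabilityMeasure P] {α : Fin n → Type u} [∀ i, Fintype (α i)]
    [∀ i, MeasurableSpace (α i)] [∀ i, MeasurableSingletonClass (α i)] {X : ∀ i, Ω → α i}
    (hX : ∀ i, Measurable (X i)) :
    ∃ h, IsEntropyFunction.{u} h ∧ entropyProfile P X = ofSetFunction h := by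
  classical
  refine ⟨fun S => shannonEntropy P (fun ω => fun i : S => X i ω), ⟨∀ i, α i, inferInstance,
    fun x => P.real ((fun ω i => X i ω) ⁻¹' {x}), α, fun i x => x i,
    fun _ => measureReal_nonneg, fun S => ?_⟩, rfl⟩
  have key (t : ∀ i : S, α i) : P.real ((fun ω => fun i : S => X i ω) ⁻¹' {t}) =
      ∑ x : ∀ i, α i,
        if (fun i : S => x i) = t then P.real ((fun ω i => X i ω) ⁻¹' {x}) else 0 := by
    have hm : Measurable fun ω i => X i ω := measurable_pi_lambda _ hX
    rw [← Finset.sum_filter, sum_measureReal_preimage_singleton _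
      (fun x _ => hm (measurableSet_singleton x))]
    congr 1
    ext ω
    simp
  unfold shannonEntropy
  rw [weightEntropy_eq_sum, ← Finset.sum_neg_distrib]
  refine Finset.sum_congr (by congr) fun t _ => ?_
  rw [key, one_div, Real.logb_inv, mul_neg]

theorem condMutualInfo_comap {m n : ℕ} (h : Finset (Fin n) → ℝ) (e : Fin m → Fin n)
    (A B C : Fin m) : condMutualInfo (ofSetFunction fun S => h (S.image e)) A B C =
      condMutualInfo (ofSetFunction h) (e A) (e B) (e C) := by
  simp only [condMutualInfo, ofSetFunction, Finset.image_insert, Finset.image_singleton]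

theorem box_comap {m n : ℕ} (h : Finset (Fin n) → ℝ) (e : Fin m → Fin n) (A B C D : Fin m) :
    box (ofSetFunction fun S => h (S.image e)) A B C D =
      box (ofSetFunction h) (e A) (e B) (e C) (e D) := by
  simp only [box, mutualInfo, condMutualInfo, ofSetFunction, Finset.image_insert,
    Finset.image_singleton]

@[fun_prop]
theorem continuous_condMutualInfo {n : ℕ} (A B C : Fin n) :
    Continuous fun h : EntropySpace n => condMutualInfo h A B C := by
  unfold condMutualInfo; fun_prop

@[fun_prop]
theorem continuous_box {n : ℕ} (A B C D : Fin n) :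
    Continuous fun h : EntropySpace n => box h A B C D := by
  unfold box mutualInfo; fun_prop

theorem isClosed_familyI4 {n : ℕ} (k : ℕ) (A B C D E : Fin n) :
    IsClosed {h : EntropySpace n | FamilyI4 k h A B C D E} :=
  isClosed_le continuous_const (by fun_prop)

theorem isClosed_familyI5 {n : ℕ} (k : ℕ) (A B C D E : Fin n) :
    IsClosed {h : EntropySpace n | FamilyI5 k h A B C D E} :=
  isClosed_le continuous_const (by fun_prop)

theorem isClosed_familyI6 {n : ℕ} (k : ℕ) (A B C D E : Fin n) :
    IsClosed {h : EntropySpace n | FamilyI6 k h A B C D E} :=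
  isClosed_le continuous_const (by fun_prop)

theorem nonneg_of_forall_nat_mul_add_nonneg {x c : ℝ} (h : ∀ k : ℕ, 0 ≤ k * x + c) : 0 ≤ x := by
  by_contra! hx
  obtain ⟨k, hk⟩ := exists_nat_gt (c / -x)
  rw [div_lt_iff₀ (by linarith)] at hk
  linarith [h k]

section Limit

variable {n : ℕ} {h : EntropySpace n} {A B C D E : Fin n}

theorem inequalityI4_of_family (H : ∀ k, FamilyI4 k h A B C D E) : InequalityI4 h A B C D E :=
  fun h1 h2 => nonneg_of_forall_nat_mul_add_nonneg fun k => by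
    simpa only [FamilyI4, h1, h2, add_zero, mul_zero] using H k

theorem inequalityI5_of_family (H : ∀ k, FamilyI5 k h A B C D E) : InequalityI5 h A B C D E :=
  fun h1 h2 => nonneg_of_forall_nat_mul_add_nonneg fun k => by
    simpa only [FamilyI5, h1, h2, add_zero, mul_zero] using H k

theorem inequalityI6_of_family (H : ∀ k, FamilyI6 k h A B C D E) : InequalityI6 h A B C D E :=
  fun h1 h2 => nonneg_of_forall_nat_mul_add_nonneg fun k => by
    simpa only [FamilyI6, h1, h2, add_zero, mul_zero] using H k

/-- With `E = D` the two additional terms are exactly the premises. -/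
theorem InequalityI4.four_variables (H : InequalityI4 h A B C D D) : InequalityI4' h A B C D :=
  fun h1 h2 => by simpa only [h1, h2, add_zero] using H h1 h2

theorem InequalityI5.four_variables (H : InequalityI5 h A B C D D) : InequalityI5' h A B C D :=
  fun h1 h2 => by simpa only [h1, h2, add_zero] using H h1 h2

/-- To be applied to the members of the families for each fixed `k`, before the limit is taken. -/
theorem IsAlmostEntropic.of_isClosed {Q : EntropySpace n → Prop} (hQ : IsClosed {g | Q g})
    (hf : ∀ f, IsEntropyFunction.{0} f → Q (ofSetFunction f)) (hh : IsAlmostEntropic h) : Q h := by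
  refine closure_minimal ?_ hQ hh
  rintro g ⟨Ω, _, P, _, α, _, _, _, X, hX, rfl⟩
  obtain ⟨f, hf', hg⟩ := entropyProfile_eq_ofSetFunction P hX
  exact hg ▸ hf f hf'

end Limit

theorem IsEntropyFunction.familyI4_four {h : Finset (Fin 4) → ℝ} (hh : IsEntropyFunction.{u} h)
    (k : ℕ) : FamilyI4 k (ofSetFunction h) 0 1 2 3 3 := by
  have := (hh.comap ![0, 1, 2, 3, 3]).familyI4 k
  simpa only [FamilyI4, condMutualInfo_comap, box_comap, Matrix.cons_val] using this

theorem IsEntropyFunction.familyI5_four {h : Finset (Fin 4) → ℝ} (hh : IsEntropyFunction.{u} h)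
    (k : ℕ) : FamilyI5 k (ofSetFunction h) 0 1 2 3 3 := by
  have := ((hh.comap ![0, 1, 2, 3, 3]).familyI5_and_familyI6 k).1
  simpa only [FamilyI5, condMutualInfo_comap, box_comap, Matrix.cons_val] using this

/-- The conditional information inequalities (I4), (I5), (I6) for five random variables, with
`A, B, C, D, E` the variables number `0, 1, 2, 3, 4`, and (I4'), (I5') for four random variables,
with `A, B, C, D` the variables number `0, 1, 2, 3`: for all distributions of random variables with
finite ranges, and for all almost entropic points. -/
theorem theorem2 :
    (∀ (Ω : Type*) [MeasurableSpace Ω] (P : Measure Ω) [IsProbabilityMeasure P]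
      (α : Fin 5 → Type*) [∀ i, Fintype (α i)] [∀ i, MeasurableSpace (α i)]
      [∀ i, MeasurableSingletonClass (α i)] (X : ∀ i, Ω → α i), (∀ i, Measurable (X i)) →
        InequalityI4 (entropyProfile P X) 0 1 2 3 4 ∧
        InequalityI5 (entropyProfile P X) 0 1 2 3 4 ∧
        InequalityI6 (entropyProfile P X) 0 1 2 3 4) ∧
    (∀ h : EntropySpace 5, IsAlmostEntropic h →
        InequalityI4 h 0 1 2 3 4 ∧ InequalityI5 h 0 1 2 3 4 ∧ InequalityI6 h 0 1 2 3 4) ∧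
    (∀ (Ω : Type*) [MeasurableSpace Ω] (P : Measure Ω) [IsProbabilityMeasure P]
      (α : Fin 4 → Type*) [∀ i, Fintype (α i)] [∀ i, MeasurableSpace (α i)]
      [∀ i, MeasurableSingletonClass (α i)] (X : ∀ i, Ω → α i), (∀ i, Measurable (X i)) →
        InequalityI4' (entropyProfile P X) 0 1 2 3 ∧
        InequalityI5' (entropyProfile P X) 0 1 2 3) ∧
    (∀ h : EntropySpace 4, IsAlmostEntropic h →
        InequalityI4' h 0 1 2 3 ∧ InequalityI5' h 0 1 2 3) := by

  refine ⟨fun Ω _ P _ α _ _ _ X hX => ?_, fun h hh => ⟨?_, ?_, ?_⟩,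
    fun Ω _ P _ α _ _ _ X hX => ?_, fun h hh => ⟨?_, ?_⟩⟩
  · obtain ⟨h, hh, he⟩ := entropyProfile_eq_ofSetFunction P hX
    rw [he]
    exact ⟨inequalityI4_of_family hh.familyI4,
      inequalityI5_of_family fun k => (hh.familyI5_and_familyI6 k).1,
      inequalityI6_of_family fun k => (hh.familyI5_and_familyI6 k).2⟩
  · exact inequalityI4_of_family fun k =>
      hh.of_isClosed (isClosed_familyI4 k _ _ _ _ _) fun f hf => hf.familyI4 k
  · exact inequalityI5_of_family fun k =>
      hh.of_isClosed (isClosed_familyI5 k _ _ _ _ _) fun f hf => (hf.familyI5_and_familyI6 k).1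
  · exact inequalityI6_of_family fun k =>
      hh.of_isClosed (isClosed_familyI6 k _ _ _ _ _) fun f hf => (hf.familyI5_and_familyI6 k).2
  · obtain ⟨h, hh, he⟩ := entropyProfile_eq_ofSetFunction P hX
    rw [he]
    exact ⟨(inequalityI4_of_family hh.familyI4_four).four_variables,
      (inequalityI5_of_family hh.familyI5_four).four_variables⟩
  · exact (inequalityI4_of_family fun k => hh.of_isClosed (isClosed_familyI4 k _ _ _ _ _)
      fun f hf => hf.familyI4_four k).four_variables
  · exact (inequalityI5_of_family fun k => hh.of_isClosed (isClosed_familyI5 k _ _ _ _ _)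
      fun f hf => hf.familyI5_four k).four_variables
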